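/- Let $H$ be the semigroup generated by the fifteen letters $L,M,P,Q,R,g,s_1,s_2,t_1,t_2,t_3,a_1,a_2,a_3,0$ subject to the following relations, in which the indices $i,j$ range over $\{1,2,3\}$ unless stated otherwise: - $0x=x0=0$ for every letter $x$ (so $0$ is a zero element of $H$); - $xL=xM=0$ for every letter $x$; - $L=MPg$; - $ga_i=a_ig$; - $gx=0$ for every letter $x\notin\{a_1,a_2,a_3\}$; - $a_iga_j=a_iRs_1Qa_j$; - $t_ix=xt_i$ for $x\in\{R,a_1,a_2,a_3\}$; - $Pa_it_i=a_iPs_1$; - $Pa_jt_i=a_jPs_2$ for $i\ne j$; - $s_ja_i=a_is_j$ for $j\in\{1,2\}$; - $s_1R=Rs_1$; - $s_1Qa_i=t_ia_iQ$; - $PRs_1=0$; - $s_2Ra_i=a_is_2R$; - $s_2RQa_i=Rt_ia_iQ$. Then $H$ is a finitely presented semigroup with zero, and its generator $L$ has the following properties. (i) The set $I=LH=\{Lh : h\in H\}$ is a two-sided ideal of $H$. It is infinite, and it is not nilpotent in the following sense: $I H^n\neq\{0\}$ for every $n\ge 0$ (where $IH^0=I$), that is, there are nonzero products $x h_1\cdots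 h_n$ with $x\in I$ and $h_1,\dots,h_n\in H$ for every $n$. (ii) If an element $A\in H$ can be written as $A=XYYZ$ with $Y\in H$ and each of $X$, $Z$ either in $H$ or empty, then $LA=0$. -/

import Mathlib

namespace SquareFreeIdeal

open scoped Pointwise

/-- A semigroup is finitely presented if it is isomorphic to the quotient of the free semigroup
on a finite alphabet by the congruence generated by finitely many relations. -/
def IsFinitelyPresented (S : Type) [Semigroup S] : Prop :=
  ∃ (α : Type) (_ : Finite α) (r : FreeSemigroup α → FreeSemigroup α → Prop),
    {p : FreeSemigroup α × FreeSemigroup α | r p.1 p.2}.Finite ∧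
      Nonempty (S ≃* (conGen r).Quotient)

/-- Two-sided ideals of a semigroup. -/
def IsTwoSidedIdeal {S : Type} [Semigroup S] (I : Set S) : Prop :=
  I.Nonempty ∧ ∀ x ∈ I, ∀ h : S, h * x ∈ I ∧ x * h ∈ I

/-- The principal right multiples `x S = {x h | h ∈ S}`. -/
def rightMultiples {S : Type} [Semigroup S] (x : S) : Set S :=
  {y | ∃ h : S, y = x * h}

/-- The set `I Sⁿ` of all products `x h₁ ⋯ hₙ` with `x ∈ I` and `h₁, …, hₙ ∈ S`. -/
def mulPow {S : Type} [Semigroup S] (I : Set S) : ℕ → Set S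
  | 0 => I
  | n + 1 => mulPow I n * Set.univ

/-- The alphabet of fifteen letters `L, M, P, Q, R, g, s₁, s₂, t₁, t₂, t₃, a₁, a₂, a₃, 0`. -/
inductive Letter : Type
  | L | M | P | Q | R | g | s₁ | s₂
  | t (i : Fin 3)
  | a (i : Fin 3)
  | zero

/-- One-letter words. -/
abbrev w (x : Letter) : FreeSemigroup Letter := FreeSemigroup.of x

open Letter in
/-- The defining relations. The first two say that the letter `0` is a zero element. -/
inductive Rel : FreeSemigroup Letter → FreeSemigroup Letter → Prop
  | zero_mul (x : Letter) : Rel (w zero * w x) (w zero)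
  | mul_zero (x : Letter) : Rel (w x * w zero) (w zero)
  | mul_L (x : Letter) : Rel (w x * w L) (w zero)
  | mul_M (x : Letter) : Rel (w x * w M) (w zero)
  | L_eq : Rel (w L) (w M * w P * w g)
  | g_a (i : Fin 3) : Rel (w g * w (a i)) (w (a i) * w g)
  | g_mul (x : Letter) (hx : ∀ i : Fin 3, x ≠ a i) : Rel (w g * w x) (w zero)
  | a_g_a (i j : Fin 3) :
      Rel (w (a i) * w g * w (a j)) (w (a i) * w R * w s₁ * w Q * w (a j))
  | t_R (i : Fin 3) : Rel (w (t i) * w R) (w R * w (t i))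
  | t_a (i j : Fin 3) : Rel (w (t i) * w (a j)) (w (a j) * w (t i))
  | P_a_t (i : Fin 3) : Rel (w P * w (a i) * w (t i)) (w (a i) * w P * w s₁)
  | P_a_t_ne (i j : Fin 3) (hij : i ≠ j) :
      Rel (w P * w (a j) * w (t i)) (w (a j) * w P * w s₂)
  | s₁_a (i : Fin 3) : Rel (w s₁ * w (a i)) (w (a i) * w s₁)
  | s₂_a (i : Fin 3) : Rel (w s₂ * w (a i)) (w (a i) * w s₂)
  | s₁_R : Rel (w s₁ * w R) (w R * w s₁)
  | s₁_Q_a (i : Fin 3) : Rel (w s₁ * w Q * w (a i)) (w (t i) * w (a i) * w Q)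
  | P_R_s₁ : Rel (w P * w R * w s₁) (w zero)
  | s₂_R_a (i : Fin 3) : Rel (w s₂ * w R * w (a i)) (w (a i) * w s₂ * w R)
  | s₂_R_Q_a (i : Fin 3) :
      Rel (w s₂ * w R * w Q * w (a i)) (w R * w (t i) * w (a i) * w Q)

/-- The semigroup `H` presented by the fifteen letters and the relations above. -/
def H : Type := (conGen Rel).Quotient

instance : Semigroup H := inferInstanceAs (Semigroup (conGen Rel).Quotient)

/-- The class in `H` of a nonempty word. -/
def toH (u : FreeSemigroup Letter) : H := (u : (conGen Rel).Quotient)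

/-- The generator of `H` given by a letter. -/
def letter (x : Letter) : H := toH (w x)

theorem toH_mul (u v : FreeSemigroup Letter) : toH (u * v) = toH u * toH v := rfl

theorem toH_eq_of_rel {u v : FreeSemigroup Letter} (h : Rel u v) : toH u = toH v :=
  (Con.eq (conGen Rel)).2 (ConGen.Rel.of u v h)

theorem toH_surjective : Function.Surjective toH := fun x =>
  Con.induction_on (C := fun y : (conGen Rel).Quotient => ∃ u, toH u = y) x (fun u => ⟨u, rfl⟩)

theorem letter_zero_mul (x : H) : letter Letter.zero * x = letter Letter.zero := by
  obtain ⟨u, rfl⟩ := toH_surjective x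
  induction u using FreeSemigroup.recOnMul with
  | ih1 y => exact toH_eq_of_rel (Rel.zero_mul y)
  | ih2 y v hy hv => rw [toH_mul, ← mul_assoc, hy, hv]

theorem mul_letter_zero (x : H) : x * letter Letter.zero = letter Letter.zero := by
  obtain ⟨u, rfl⟩ := toH_surjective x
  induction u using FreeSemigroup.recOnMul with
  | ih1 y => exact toH_eq_of_rel (Rel.mul_zero y)
  | ih2 y v hy hv => rw [toH_mul, mul_assoc, hv, hy]

instance : SemigroupWithZero H :=
  { (inferInstance : Semigroup H) with
    zero := letter Letter.zero
    zero_mul := letter_zero_mul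
    mul_zero := mul_letter_zero }

end SquareFreeIdeal

open SquareFreeIdeal

namespace SquareFreeIdeal

/-! Vanishing on squares. Since `L = MPg` and `g` commutes with the `aᵢ`, in `L a_{i₁} ⋯ a_{iₙ}` the
letter `g` can be moved between any two `a`'s and turned into `R s₁ Q` there. The markers form a
machine comparing the letter after `P` with the letter after `Q`, at constant distance: the letter
after `Q` turns `s₁` into `tᵢ`, which travels back to `P`. A match advances `P` and `Q`; a mismatch
also advances them, but sends out `s₂`, which drags `R` up to `Q` and so restarts the comparison. If
`P` reaches `R`, a whole period has matched and `P R s₁ = 0`. With distance `|Y|` this kills every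
word in the `aᵢ` containing `YY` (`compare_eq_zero`); words with other letters are killed by `g`
(`L_mul_aProd_mul`).

Nonvanishing. For a square-free sequence `W`, a partial automaton reading along `W` respects all
relations (`run_eq_of_rel`) and accepts every `L a_{W 0} ⋯ a_{W n}`, ending in different states for
different `n`. These elements are thus nonzero and distinct. Thue's ternary sequence supplies `W`.
-/

/-! ### A square-free sequence over three letters. -/

/-- The Thue–Morse sequence. -/
def thueMorse (n : ℕ) : Bool := (Nat.digits 2 n).sum.bodd

theorem thueMorse_two_mul (n : ℕ) : thueMorse (2 * n) = thueMorse n := by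
  rcases Nat.eq_zero_or_pos n with rfl | hn
  · rfl
  · rw [thueMorse, Nat.digits_def' (by omega) (by omega), Nat.mul_mod_right,
      Nat.mul_div_cancel_left n (by omega), List.sum_cons, zero_add, thueMorse]

theorem thueMorse_two_mul_add_one (n : ℕ) : thueMorse (2 * n + 1) = !thueMorse n := by
  rw [thueMorse, Nat.digits_def' (by omega) (by omega), show (2 * n + 1) % 2 = 1 by omega,
    show (2 * n + 1) / 2 = n by omega, List.sum_cons, Nat.bodd_add, thueMorse]
  simp

theorem thueMorse_ne_of_even {n : ℕ} (h : Even n) : thueMorse n ≠ thueMorse (n + 1) := by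
  obtain ⟨m, rfl⟩ := h
  rw [← two_mul, thueMorse_two_mul, thueMorse_two_mul_add_one]
  simp

theorem thueMorse_not_three_equal (n : ℕ) :
    ¬ (thueMorse n = thueMorse (n + 1) ∧ thueMorse (n + 1) = thueMorse (n + 2)) := by
  rintro ⟨h₁, h₂⟩
  rcases Nat.even_or_odd n with h | h
  · exact thueMorse_ne_of_even h h₁
  · exact thueMorse_ne_of_even (n := n + 1) (by grind) h₂

/-- Changes of value after the odd positions `2m + 1` and `2m + 3` force equal values at `m`, `m +
1`, `m + 2`. -/
theorem thueMorse_not_five_alternating (n : ℕ) :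
    ¬ ∀ i < 5, thueMorse (n + i) ≠ thueMorse (n + i + 1) := by
  intro h
  have key : ∀ m, thueMorse (2 * m + 1) ≠ thueMorse (2 * m + 2) → thueMorse m = thueMorse (m + 1) := by
    intro m hm
    rw [thueMorse_two_mul_add_one, show 2 * m + 2 = 2 * (m + 1) by ring, thueMorse_two_mul] at hm
    revert hm
    cases thueMorse m <;> cases thueMorse (m + 1) <;> simp
  obtain ⟨m, i, hi, hm⟩ : ∃ m i, i < 2 ∧ n + i = 2 * m + 1 := by
    rcases Nat.even_or_odd' n with ⟨m, hm | hm⟩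
    · exact ⟨m, 1, by omega, by omega⟩
    · exact ⟨m, 0, by omega, by omega⟩
  refine thueMorse_not_three_equal m ⟨key m ?_, key (m + 1) ?_⟩
  · have := h i (by omega)
    rwa [hm] at this
  · have := h (i + 2) (by omega)
    rwa [show n + (i + 2) = 2 * (m + 1) + 1 by omega] at this

/-- An even period can be halved. For an odd one, `p + j` and `p + k + j` have opposite parity, so
one of them is even and the value changes after both: the overlap alternates, which is too long once
`k ≥ 3`. -/
theorem thueMorse_overlapFree (k : ℕ) (hk : 0 < k) (p : ℕ) :
    ¬ ∀ j ≤ k, thueMorse (p + j) = thueMorse (p + k + j) := by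
  induction k using Nat.strong_induction_on generalizing p with
  | _ k ih =>
  intro h
  rcases Nat.even_or_odd' k with ⟨m, rfl | rfl⟩
  · rcases Nat.even_or_odd' p with ⟨q, rfl | rfl⟩
    · refine ih m (by omega) (by omega) q fun j hj => ?_
      have := h (2 * j) (by omega)
      rwa [← mul_add, ← mul_add, ← mul_add, thueMorse_two_mul, thueMorse_two_mul] at this
    · refine ih m (by omega) (by omega) q fun j hj => ?_
      have := h (2 * j) (by omega)
      rw [show 2 * q + 1 + 2 * j = 2 * (q + j) + 1 by ring,
        show 2 * q + 1 + 2 * m + 2 * j = 2 * (q + m + j) + 1 by ring,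
        thueMorse_two_mul_add_one, thueMorse_two_mul_add_one] at this
      simpa using this
  · rcases Nat.eq_zero_or_pos m with rfl | hm
    · have h₀ := h 0 (by omega)
      have h₁ := h 1 (by omega)
      exact thueMorse_not_three_equal p ⟨by simpa using h₀, by simpa using h₁⟩
    · have alt : ∀ j < 2 * m + 1, thueMorse (p + j) ≠ thueMorse (p + j + 1) ∧
          thueMorse (p + (2 * m + 1) + j) ≠ thueMorse (p + (2 * m + 1) + j + 1) := by
        intro j hj
        have h₀ := h j (by omega)
        have h₁ := h (j + 1) (by omega)
        rw [← add_assoc, ← add_assoc] at h₁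
        rw [← h₀, ← h₁, and_self]
        rcases Nat.even_or_odd (p + j) with he | ho
        · exact thueMorse_ne_of_even he
        · rw [h₀, h₁]
          exact thueMorse_ne_of_even (by grind)
      refine thueMorse_not_five_alternating p fun i hi => ?_
      rcases lt_or_ge i (2 * m + 1) with h' | h'
      · exact (alt i h').1
      · have := (alt (i - (2 * m + 1)) (by omega)).2
        rwa [show p + (2 * m + 1) + (i - (2 * m + 1)) = p + i by omega] at this

/-- The ternary Thue sequence, recording the differences of the Thue–Morse sequence. -/
def ternaryThue (n : ℕ) : Fin 3 :=
  if thueMorse n = thueMorse (n + 1) then 0 else if thueMorse n then 1 else 2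

theorem ternaryThue_eq_zero_iff (n : ℕ) :
    ternaryThue n = 0 ↔ thueMorse n = thueMorse (n + 1) := by
  unfold ternaryThue
  split_ifs <;> simp_all

theorem thueMorse_eq_of_ternaryThue_ne_zero {m n : ℕ} (h : ternaryThue m = ternaryThue n)
    (h₀ : ternaryThue m ≠ 0) : thueMorse m = thueMorse n := by
  unfold ternaryThue at h h₀
  generalize thueMorse m = b, thueMorse (m + 1) = b', thueMorse n = c, thueMorse (n + 1) = c' at *
  revert b b' c c'
  decide

/-- In an infinite square-free sequence no two adjacent blocks of equal positive length agree. -/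
def SquareFreeSeq {α : Type*} (W : ℕ → α) : Prop :=
  ∀ p k, 0 < k → ∃ m, p ≤ m ∧ m < p + k ∧ W m ≠ W (m + k)

/-- On a square, the two Thue–Morse blocks agree everywhere or nowhere. Agreement is an overlap.
Disagreement excludes the letters `1` and `2`, which determine the Thue–Morse value, so the sequence
is constant up to `p + k`, contradicting disagreement at `p`. -/
theorem squareFreeSeq_ternaryThue : SquareFreeSeq ternaryThue := by
  intro p k hk
  by_contra! H
  have hW : ∀ j < k, ternaryThue (p + j) = ternaryThue (p + k + j) := fun j hj => by
    rw [H (p + j) (by omega) (by omega)]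
    congr 1
    ring
  have step : ∀ j < k, (thueMorse (p + j) = thueMorse (p + k + j) ↔
      thueMorse (p + (j + 1)) = thueMorse (p + k + (j + 1))) := by
    intro j hj
    have h := hW j hj
    have h₁ := ternaryThue_eq_zero_iff (p + j)
    have h₂ := ternaryThue_eq_zero_iff (p + k + j)
    rw [h] at h₁
    rw [h₁, add_assoc, add_assoc _ j] at h₂
    revert h₂
    cases thueMorse (p + j) <;> cases thueMorse (p + k + j) <;>
      cases thueMorse (p + (j + 1)) <;> cases thueMorse (p + k + (j + 1)) <;> simp
  have all : ∀ j ≤ k, (thueMorse p = thueMorse (p + k) ↔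
      thueMorse (p + j) = thueMorse (p + k + j)) := by
    intro j
    induction j with
    | zero => simp
    | succ j ih => exact fun hj => (ih (by omega)).trans (step j (by omega))
  by_cases hp : thueMorse p = thueMorse (p + k)
  · exact thueMorse_overlapFree k hk p fun j hj => (all j hj).1 hp
  · have zero : ∀ j < k, ternaryThue (p + j) = 0 := by
      intro j hj
      by_contra h₀
      exact hp ((all j hj.le).2 (thueMorse_eq_of_ternaryThue_ne_zero (hW j hj) h₀))
    have const : ∀ j ≤ k, thueMorse (p + j) = thueMorse p := by
      intro j
      induction j with
      | zero => simp
      | succ j ih =>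
        intro hj
        rw [← ih (by omega), ← add_assoc]
        exact ((ternaryThue_eq_zero_iff _).1 (zero j (by omega))).symm
    exact hp (const k le_rfl).symm

/-! ### The comparing machine: `L` annihilates squares. -/

/-- A zero element stays one after adjoining an identity. -/
noncomputable instance : MonoidWithZero (WithOne H) :=
  { (inferInstance : Monoid (WithOne H)) with
    zero := ((0 : H) : WithOne H)
    zero_mul := fun x =>
      WithOne.cases_on x (mul_one _) fun x => congrArg WithOne.coe (zero_mul x)
    mul_zero := fun x =>
      WithOne.cases_on x (one_mul _) fun x => congrArg WithOne.coe (mul_zero x) }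

theorem coe_zero : ((0 : H) : WithOne H) = 0 := rfl

/-- The image of a letter in `H` with an identity adjoined. -/
def gen (x : Letter) : WithOne H := (letter x : H)

/-- The product of the letters `aᵢ` along a list of indices. -/
noncomputable def aProd (l : List (Fin 3)) : WithOne H := (l.map fun i => gen (.a i)).prod

theorem coe_toH_mul (u v : FreeSemigroup Letter) :
    ((toH (u * v) : H) : WithOne H) = toH u * toH v := rfl

@[simp] theorem aProd_nil : aProd [] = 1 := rfl

@[simp] theorem aProd_cons (i : Fin 3) (l : List (Fin 3)) :
    aProd (i :: l) = gen (.a i) * aProd l := by simp [aProd]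

theorem aProd_append (l m : List (Fin 3)) : aProd (l ++ m) = aProd l * aProd m := by
  simp [aProd]

theorem coe_toH_eq {u v : FreeSemigroup Letter} (h : Rel u v) :
    ((toH u : H) : WithOne H) = toH v := congrArg _ (toH_eq_of_rel h)

open Letter

theorem commute_aProd {y : WithOne H} (h : ∀ i, Commute y (gen (a i))) (l : List (Fin 3)) :
    Commute y (aProd l) := by
  induction l with
  | nil => exact Commute.one_right y
  | cons i l ih => rw [aProd_cons]; exact (h i).mul_right ih

theorem g_comm (l : List (Fin 3)) : Commute (gen g) (aProd l) :=
  commute_aProd (y := gen g) (fun i => coe_toH_eq (Rel.g_a i)) l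

theorem s₁_comm (l : List (Fin 3)) : Commute (gen s₁) (aProd l) :=
  commute_aProd (y := gen s₁) (fun i => coe_toH_eq (Rel.s₁_a i)) l

theorem s₂_comm (l : List (Fin 3)) : Commute (gen s₂) (aProd l) :=
  commute_aProd (y := gen s₂) (fun i => coe_toH_eq (Rel.s₂_a i)) l

theorem t_comm (i : Fin 3) (l : List (Fin 3)) : Commute (gen (t i)) (aProd l) :=
  commute_aProd (y := gen (t i)) (fun j => coe_toH_eq (Rel.t_a i j)) l

theorem t_comm_R (i : Fin 3) : Commute (gen (t i)) (gen R) := coe_toH_eq (Rel.t_R i)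

theorem s₁_comm_R : Commute (gen s₁) (gen R) := coe_toH_eq Rel.s₁_R

theorem L_eq : gen L = gen M * gen P * gen g := coe_toH_eq Rel.L_eq

theorem g_mul {x : Letter} (hx : ∀ i, x ≠ a i) : gen g * gen x = 0 := coe_toH_eq (Rel.g_mul x hx)

theorem a_g_a (i j : Fin 3) :
    gen (a i) * gen g * gen (a j) = gen (a i) * gen R * gen s₁ * gen Q * gen (a j) :=
  coe_toH_eq (Rel.a_g_a i j)

theorem P_a_t (i : Fin 3) : gen P * gen (a i) * gen (t i) = gen (a i) * gen P * gen s₁ :=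
  coe_toH_eq (Rel.P_a_t i)

theorem P_a_t_ne {i j : Fin 3} (h : i ≠ j) :
    gen P * gen (a j) * gen (t i) = gen (a j) * gen P * gen s₂ :=
  coe_toH_eq (Rel.P_a_t_ne i j h)

theorem s₁_Q_a (i : Fin 3) : gen s₁ * (gen Q * gen (a i)) = gen (t i) * (gen (a i) * gen Q) :=
  coe_toH_eq (Rel.s₁_Q_a i)

theorem P_R_s₁ : gen P * gen R * gen s₁ = 0 := coe_toH_eq Rel.P_R_s₁

theorem s₂_R_aProd (l : List (Fin 3)) :
    gen s₂ * gen R * aProd l = aProd l * (gen s₂ * gen R) :=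
  commute_aProd (y := gen s₂ * gen R) (fun i => coe_toH_eq (Rel.s₂_R_a i)) l

theorem s₂_R_Q_a (i : Fin 3) :
    gen s₂ * gen R * gen Q * gen (a i) = gen R * gen s₁ * gen Q * gen (a i) :=
  (coe_toH_eq (Rel.s₂_R_Q_a i)).trans <| by
    change gen R * gen (t i) * gen (a i) * gen Q = _
    simp only [mul_assoc, s₁_Q_a]

/-- Reading the letter after `Q` turns the token `s₁` into `tᵢ`, which travels back to `P`. -/
theorem read_letter (c b : Fin 3) (u v : List (Fin 3)) :
    gen P * aProd (c :: u) * gen R * aProd v * gen s₁ * gen Q * gen (a b) =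
      gen P * gen (a c) * gen (t b) * aProd u * gen R * aProd v * gen (a b) * gen Q := by
  have h := ((t_comm b u).mul_right (t_comm_R b)).mul_right (t_comm b v)
  calc _ = gen P * gen (a c) * ((aProd u * gen R * aProd v) * gen (t b)) * gen (a b) * gen Q := by
        simp only [aProd_cons, mul_assoc, s₁_Q_a]
    _ = _ := by rw [← h.eq]; simp only [mul_assoc]

theorem match_step (c : Fin 3) (u v : List (Fin 3)) :
    gen P * aProd (c :: u) * gen R * aProd v * gen s₁ * gen Q * gen (a c) =
      gen (a c) * (gen P * aProd u * gen R * aProd (v ++ [c]) * gen s₁ * gen Q) := by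
  have h := ((s₁_comm u).mul_right s₁_comm_R).mul_right (s₁_comm (v ++ [c]))
  rw [read_letter, P_a_t]
  calc _ = gen (a c) * gen P * (gen s₁ * (aProd u * gen R * aProd (v ++ [c]))) * gen Q := by
        simp [aProd_append, mul_assoc]
    _ = _ := by rw [h.eq]; simp only [mul_assoc]

/-- The further letter `d` is needed because `s₂ R Q` is rewritten only in front of some `aᵢ`. -/
theorem mismatch_step {c b : Fin 3} (hbc : b ≠ c) (d : Fin 3) (u v : List (Fin 3)) :
    gen P * aProd (c :: u) * gen R * aProd v * gen s₁ * gen Q * gen (a b) * gen (a d) =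
      gen (a c) * (gen P * aProd (u ++ v ++ [b]) * gen R * gen s₁ * gen Q * gen (a d)) := by
  rw [read_letter, P_a_t_ne hbc]
  calc _ = gen (a c) * gen P * (gen s₂ * aProd u) * gen R * aProd (v ++ [b]) * gen Q *
          gen (a d) := by simp [aProd_append, mul_assoc]
    _ = gen (a c) * gen P * aProd u * (gen s₂ * gen R * aProd (v ++ [b])) * gen Q * gen (a d) := by
        rw [(s₂_comm u).eq]; simp only [mul_assoc]
    _ = gen (a c) * gen P * aProd u * aProd (v ++ [b]) *
          (gen s₂ * gen R * gen Q * gen (a d)) := by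
        rw [s₂_R_aProd]; simp only [mul_assoc]
    _ = _ := by rw [s₂_R_Q_a]; simp [aProd_append, mul_assoc]

/-- Matches use up `u` until `P` meets `R`; then `s₁` moves left past `v` and `P R s₁ = 0` applies.
-/
theorem initial_square_eq_zero (u v : List (Fin 3)) :
    gen P * aProd u * gen R * aProd v * gen s₁ * gen Q * aProd u = 0 := by
  induction u generalizing v with
  | nil =>
    simp only [aProd_nil, mul_one]
    rw [mul_assoc (gen P * gen R), ← (s₁_comm v).eq, ← mul_assoc, P_R_s₁]
    simp
  | cons c u ih =>
    rw [aProd_cons c u, ← mul_assoc, ← aProd_cons, match_step, mul_assoc, ih, mul_zero]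

/-- The word machine detects every square whose period is the distance from `P` to `Q`. -/
theorem compare_eq_zero (v : List (Fin 3)) : ∀ (u₁ u₂ x y z : List (Fin 3)), y ≠ [] →
    u₁.length + u₂.length = y.length → u₁ ++ u₂ ++ v = x ++ y ++ y ++ z →
    gen P * aProd u₁ * gen R * aProd u₂ * gen s₁ * gen Q * aProd v = 0 := by
  induction v with
  | nil =>
    intro u₁ u₂ x y z hy hl h
    have := congrArg List.length h
    have := List.length_pos_iff.2 hy
    simp at *
    omega
  | cons b v ih =>
    intro u₁ u₂ x y z hy hl h
    have hy' := List.length_pos_iff.2 hy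
    have hlen := congrArg List.length h
    simp only [List.length_append, List.length_cons] at hlen
    cases x with
    | nil =>
      obtain ⟨rfl, hv⟩ := List.append_inj (s₁ := u₁ ++ u₂) (s₂ := y) (t₁ := b :: v) (t₂ := y ++ z)
        (by simpa using h) (by simpa using hl)
      rw [hv, List.append_assoc, aProd_append, ← mul_assoc, initial_square_eq_zero, zero_mul]
    | cons c x =>
      cases u₁ with
      | nil => 
        have := initial_square_eq_zero [] u₂
        rw [aProd_nil, mul_one] at this
        rw [aProd_nil, this, zero_mul]
      | cons c' u₁ =>
        obtain ⟨rfl, h⟩ : c' = c ∧ u₁ ++ u₂ ++ b :: v = x ++ y ++ y ++ z := by simpa using h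
        simp only [List.length_cons] at hl hlen
        by_cases hb : b = c'
        · subst hb
          rw [aProd_cons b v, ← mul_assoc, match_step, mul_assoc,
            ih u₁ (u₂ ++ [b]) x y z hy (by simp; omega) (by simpa using h), mul_zero]
        · cases v with
          -- The square lies beyond `P`, so at least one more letter must follow a mismatch.
          | nil => simp at hlen; omega
          | cons d v =>
            have := ih (u₁ ++ u₂ ++ [b]) [] x y z hy (by simp; omega) (by simpa using h)
            rw [aProd_cons b, aProd_cons d, ← mul_assoc, ← mul_assoc, mismatch_step hb, mul_assoc]
            simp only [aProd_cons d, aProd_nil, mul_one, ← mul_assoc] at this ⊢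
            simp only [mul_assoc] at this ⊢
            rw [this, mul_zero]

theorem aProd_g_aProd {u v : List (Fin 3)} (hu : u ≠ []) (hv : v ≠ []) :
    aProd u * gen g * aProd v = aProd u * gen R * gen s₁ * gen Q * aProd v := by
  obtain ⟨u, i, rfl⟩ := List.eq_nil_or_concat u |>.resolve_left hu
  obtain ⟨j, v, rfl⟩ := List.exists_cons_of_ne_nil hv
  have := congrArg (fun w => aProd u * w * aProd v) (a_g_a i j)
  simpa [aProd_append, mul_assoc] using this

theorem L_mul_square_eq_zero (x y z : List (Fin 3)) (hy : y ≠ []) :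
    gen L * aProd (x ++ y ++ y ++ z) = 0 := by
  have hy' := List.length_pos_iff.2 hy
  set l := x ++ y ++ y ++ z with hl
  have hlen := congrArg List.length hl
  simp only [List.length_append] at hlen
  have hu : l.take y.length ≠ [] := List.length_pos_iff.1 (by rw [List.length_take]; omega)
  have hv : l.drop y.length ≠ [] := List.length_pos_iff.1 (by rw [List.length_drop]; omega)
  -- Cutting after `|y|` letters makes the distance from `P` to `Q` equal to the period.
  have := compare_eq_zero (l.drop y.length) (l.take y.length) [] x y z hy
    (by simp; omega) (by simp [hl])
  rw [← List.take_append_drop y.length l, aProd_append, L_eq]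
  calc _ = gen M * (gen P * (gen g * aProd (l.take y.length)) * aProd (l.drop y.length)) := by
        simp only [mul_assoc]
    _ = gen M * (gen P * (aProd (l.take y.length) * gen g * aProd (l.drop y.length))) := by
        rw [(g_comm _).eq]; simp only [mul_assoc]
    _ = 0 := by
        rw [aProd_g_aProd hu hv]
        simp only [aProd_nil, mul_one] at this
        simp only [mul_assoc] at this ⊢
        rw [this, mul_zero]

/-- The `g` inside `L` moves right until it meets `x`. -/
theorem L_mul_aProd_mul {x : Letter} (hx : ∀ i, x ≠ a i) (l : List (Fin 3)) (h : WithOne H) :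
    gen L * (aProd l * (gen x * h)) = 0 := by
  rw [L_eq, mul_assoc, ← mul_assoc (gen g), (g_comm l).eq, mul_assoc (aProd l),
    ← mul_assoc (gen g), g_mul hx, zero_mul, mul_zero, mul_zero]

theorem exists_word_of_H (h : H) :
    (∃ l ≠ [], (h : WithOne H) = aProd l) ∨
      ∃ (l : List (Fin 3)) (x : Letter) (k : WithOne H),
        (∀ i, x ≠ a i) ∧ (h : WithOne H) = aProd l * (gen x * k) := by
  obtain ⟨u, rfl⟩ := toH_surjective h
  have single (x : Letter) : (∃ i, x = a i) ∨ ∀ i, x ≠ a i := by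
    by_cases hx : ∃ i, x = a i
    · exact .inl hx
    · exact .inr (by simpa using hx)
  induction u using FreeSemigroup.recOnMul with
  | ih1 y =>
    rcases single y with ⟨i, rfl⟩ | hy
    · exact .inl ⟨[i], by simp, by simp; rfl⟩
    · exact .inr ⟨[], y, 1, hy, by simp; rfl⟩
  | ih2 y v _ hv =>
    rw [coe_toH_mul]
    change _ ∨ ∃ l x k, _ ∧ gen y * _ = _
    rcases single y with ⟨i, rfl⟩ | hy
    · rcases hv with ⟨l, -, hl⟩ | ⟨l, x, k, hx, hl⟩
      · exact .inl ⟨i :: l, by simp, by rw [hl, aProd_cons]; rfl⟩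
      · exact .inr ⟨i :: l, x, k, hx, by rw [hl, aProd_cons, mul_assoc]⟩
    · exact .inr ⟨[], y, _, hy, by rw [aProd_nil, one_mul]⟩

theorem exists_word (h : WithOne H) :
    (∃ l, h = aProd l) ∨
      ∃ (l : List (Fin 3)) (x : Letter) (k : WithOne H),
        (∀ i, x ≠ a i) ∧ h = aProd l * (gen x * k) := by
  refine WithOne.cases_on h (.inl ⟨[], rfl⟩) fun h => ?_
  exact (exists_word_of_H h).imp_left fun ⟨l, _, hl⟩ => ⟨l, hl⟩

theorem L_mul_eq_zero_of_square (A Y : H) (X Z : WithOne H)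
    (hA : (A : WithOne H) = X * (Y : WithOne H) * (Y : WithOne H) * Z) :
    letter L * A = 0 := by
  apply WithOne.coe_inj.1
  rw [coe_zero, WithOne.coe_mul, hA]
  change gen L * _ = 0
  rcases exists_word X with ⟨x, rfl⟩ | ⟨l, b, k, hb, rfl⟩
  swap
  · simpa only [mul_assoc] using L_mul_aProd_mul hb l _
  rcases exists_word_of_H Y with ⟨y, hy, hY⟩ | ⟨l, b, k, hb, hY⟩
  swap
  · rw [hY]
    simpa only [aProd_append, mul_assoc] using
      L_mul_aProd_mul hb (x ++ l) (k * (aProd l * (gen b * k)) * Z)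
  rw [hY]
  rcases exists_word Z with ⟨z, rfl⟩ | ⟨l, b, k, hb, rfl⟩
  swap
  · simpa only [aProd_append, mul_assoc] using L_mul_aProd_mul hb (x ++ y ++ y ++ l) k
  simpa only [aProd_append] using L_mul_square_eq_zero x y z hy

/-! ### An automaton compatible with the relations. -/

/-- States of the automaton reading words that start with `L` or `M`. The last parameter counts the
letters `aᵢ` read so far, `p` and `r` are the positions of `P` and `R` among them. -/
inductive State : Type
  | start
  | M (n : ℕ)
  | MP (p n : ℕ)
  | s₁ (p n : ℕ)
  | s₂ (p n : ℕ)
  | MPR (p r n : ℕ)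
  | s₁R (p r n : ℕ)
  | s₂R (p n : ℕ)
  | done (n : ℕ)

/-- Comparing from position `p` at distance `k`, a mismatch occurs before position `r`. -/
def Mismatch (W : ℕ → Fin 3) (p r k : ℕ) : Prop :=
  ∃ m, p ≤ m ∧ m < r ∧ W m ≠ W (m + k)

theorem Mismatch.lt {W : ℕ → Fin 3} {p r k : ℕ} (h : Mismatch W p r k) : p < r := by
  obtain ⟨m, h₁, h₂, -⟩ := h
  exact h₁.trans_lt h₂

/-- One step of the machine: compare at `p` and `n`, then advance both markers. This is what makes
`s₁ Q aᵢ = tᵢ aᵢ Q` hold on states. -/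
theorem mismatch_iff (W : ℕ → Fin 3) {p n : ℕ} (r : ℕ) (h : p ≤ n) :
    Mismatch W p r (n - p) ↔
      p < r ∧ (W p ≠ W n ∨ Mismatch W (p + 1) r (n + 1 - (p + 1))) := by
  rw [Nat.add_sub_add_right]
  constructor
  · rintro ⟨m, h₁, h₂, h₃⟩
    refine ⟨by omega, ?_⟩
    rcases h₁.eq_or_lt with rfl | h'
    · exact .inl (by rwa [Nat.add_sub_cancel' h] at h₃)
    · exact .inr ⟨m, h', h₂, h₃⟩
  · rintro ⟨h', h₃ | ⟨m, h₁, h₂, h₃⟩⟩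
    · exact ⟨p, le_rfl, h', by rwa [Nat.add_sub_cancel' h]⟩
    · exact ⟨m, by omega, h₂, h₃⟩

open Classical in
/-- The transitions of the automaton along a sequence `W`. A letter `tᵢ` acts as the letter `s₁` or
`s₂` into which the next comparison turns it. -/
noncomputable def step (W : ℕ → Fin 3) : Letter → State → Option State
  | .L, .start => some (.done 0)
  | .M, .start => some (.M 0)
  | .P, .M n => some (.MP n n)
  | .g, .MP p n => if p ≤ n then some (.done n) else none
  | .R, .MP p n => if p ≤ n then some (.MPR p n n) else none
  | .R, .s₁ p n => if p < n then some (.s₁R p n n) else none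
  | .R, .s₂ p n => if p ≤ n then some (.s₂R p n) else none
  | .s₁, .MP p n => if p ≤ n then some (.s₁ p n) else none
  | .s₁, .MPR p r n => if p < r ∧ r ≤ n then some (.s₁R p r n) else none
  | .s₂, .MP p n => if p ≤ n then some (.s₂ p n) else none
  -- The case `p = n` is allowed since `tᵢ` commutes with the `aⱼ` and may precede the letter it is
  -- compared with; the new position `p + 1` can then exceed `n`.
  | .t i, .MP p n =>
      if p ≤ n then if W p = i then some (.s₁ (p + 1) n) else some (.s₂ (p + 1) n) else none
  | .t i, .MPR p r n =>
      if p < r ∧ r ≤ n then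
        if W p = i then if p + 1 < r then some (.s₁R (p + 1) r n) else none
        else some (.s₂R (p + 1) n)
      else none
  -- A mismatch before `R` is what keeps the machine from reaching `P R s₁`.
  | .Q, .s₁R p r n =>
      if Mismatch W p r (n - p) then some (.done n) else none
  | .Q, .s₂R p n => if p < n then some (.done n) else none
  | .a i, .M n => if W n = i then some (.M (n + 1)) else none
  | .a i, .MP p n => if W n = i ∧ p ≤ n then some (.MP p (n + 1)) else none
  | .a i, .s₁ p n => if W n = i then some (.s₁ p (n + 1)) else none
  | .a i, .s₂ p n => if W n = i then some (.s₂ p (n + 1)) else none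
  | .a i, .MPR p r n => if W n = i ∧ p ≤ r ∧ r ≤ n then some (.MPR p r (n + 1)) else none
  | .a i, .s₁R p r n => if W n = i then some (.s₁R p r (n + 1)) else none
  | .a i, .s₂R p n => if W n = i then some (.s₂R p (n + 1)) else none
  | .a i, .done n => if W n = i then some (.done (n + 1)) else none
  | _, _ => none

/-- The right action of words on states, with `none` as the failure state. -/
noncomputable def act (W : ℕ → Fin 3) :
    FreeSemigroup Letter →ₙ* (Function.End (Option State))ᵐᵒᵖ :=
  FreeSemigroup.lift fun x => .op fun s => s.bind (step W x)

/-- Reading a word from a state. -/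
noncomputable def run (W : ℕ → Fin 3) (u : FreeSemigroup Letter) (s : Option State) :
    Option State := (act W u).unop s

theorem run_mul (W : ℕ → Fin 3) (u v : FreeSemigroup Letter) (s : Option State) :
    run W (u * v) s = run W v (run W u s) := by
  simp only [run, map_mul]; rfl

theorem run_w (W : ℕ → Fin 3) (x : Letter) (s : Option State) :
    run W (w x) s = s.bind (step W x) := rfl

theorem step_ne_start (W : ℕ → Fin 3) (x : Letter) (s : State) : step W x s ≠ some .start := by
  cases x <;> cases s <;> simp [step] <;> grind

theorem ite_bind {α β : Type*} (c : Prop) [Decidable c] (x y : Option α) (f : α → Option β) :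
    (if c then x else y).bind f = if c then x.bind f else y.bind f := by
  split_ifs <;> rfl

theorem mismatch_of_squareFreeSeq {W : ℕ → Fin 3} (hW : SquareFreeSeq W) (p n : ℕ)
    (h : p < n) : Mismatch W p n (n - p) := by
  obtain ⟨m, h₁, h₂, h₃⟩ := hW p (n - p) (by omega)
  exact ⟨m, h₁, by omega, h₃⟩

theorem run_g_a (W : ℕ → Fin 3) (i : Fin 3) (s : State) :
    run W (w g * w (a i)) (some s) = run W (w (a i) * w g) (some s) := by
  cases s <;> simp [run_mul, run_w, step, ite_bind]
  grind

theorem run_t_R (W : ℕ → Fin 3) (i : Fin 3) (s : State) :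
    run W (w (t i) * w R) (some s) = run W (w R * w (t i)) (some s) := by
  cases s <;> simp [run_mul, run_w, step, ite_bind]
  grind

theorem run_t_a (W : ℕ → Fin 3) (i j : Fin 3) (s : State) :
    run W (w (t i) * w (a j)) (some s) = run W (w (a j) * w (t i)) (some s) := by
  cases s <;> simp [run_mul, run_w, step, ite_bind] <;> grind

theorem run_P_a_t (W : ℕ → Fin 3) (i : Fin 3) (s : State) :
    run W (w P * w (a i) * w (t i)) (some s) = run W (w (a i) * w P * w s₁) (some s) := by
  cases s <;> simp [run_mul, run_w, step, ite_bind]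
  grind

theorem run_P_a_t_ne (W : ℕ → Fin 3) {i j : Fin 3} (hij : i ≠ j) (s : State) :
    run W (w P * w (a j) * w (t i)) (some s) = run W (w (a j) * w P * w s₂) (some s) := by
  cases s <;> simp [run_mul, run_w, step, ite_bind]
  grind

theorem run_s₁_a (W : ℕ → Fin 3) (i : Fin 3) (s : State) :
    run W (w s₁ * w (a i)) (some s) = run W (w (a i) * w s₁) (some s) := by
  cases s <;> simp [run_mul, run_w, step, ite_bind] <;> grind

theorem run_s₂_a (W : ℕ → Fin 3) (i : Fin 3) (s : State) :
    run W (w s₂ * w (a i)) (some s) = run W (w (a i) * w s₂) (some s) := by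
  cases s <;> simp [run_mul, run_w, step, ite_bind]
  grind

theorem run_s₁_R (W : ℕ → Fin 3)  (s : State) :
    run W (w s₁ * w R) (some s) = run W (w R * w s₁) (some s) := by
  cases s <;> simp [run_mul, run_w, step, ite_bind]

theorem run_s₁_Q_a (W : ℕ → Fin 3) (i : Fin 3) (s : State) :
    run W (w s₁ * w Q * w (a i)) (some s) = run W (w (t i) * w (a i) * w Q) (some s) := by
  cases s
  case MPR p r n =>
    have h₁ := mismatch_iff W (p := p) (n := n) r
    have h₂ := Mismatch.lt (W := W) (p := p + 1) (r := r) (k := n + 1 - (p + 1))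
    simp [run_mul, run_w, step, ite_bind]
    generalize Mismatch W (p + 1) r (n + 1 - (p + 1)) = A at *
    generalize Mismatch W p r (n - p) = B at *
    grind
  all_goals simp [run_mul, run_w, step, ite_bind]

theorem run_P_R_s₁ (W : ℕ → Fin 3)  (s : State) :
    run W (w P * w R * w s₁) (some s) = run W (w zero) (some s) := by
  cases s <;> simp [run_mul, run_w, step]

theorem run_s₂_R_a (W : ℕ → Fin 3) (i : Fin 3) (s : State) :
    run W (w s₂ * w R * w (a i)) (some s) = run W (w (a i) * w s₂ * w R) (some s) := by
  cases s <;> simp [run_mul, run_w, step, ite_bind]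
  grind

/-- Square-freeness enters only here and in `run_s₂_R_Q_a`, where `R` is put next to `Q`: a mismatch
must then exist within the whole period. -/
theorem run_a_g_a {W : ℕ → Fin 3} (hW : SquareFreeSeq W) (i j : Fin 3) (s : State) :
    run W (w (a i) * w g * w (a j)) (some s) = run W (w (a i) * w R * w s₁ * w Q * w (a j)) (some s) := by
  cases s
  case MP p n =>
    have := mismatch_of_squareFreeSeq hW p (n + 1)
    simp [run_mul, run_w, step, ite_bind]
    grind
  all_goals simp [run_mul, run_w, step, ite_bind]

theorem run_s₂_R_Q_a {W : ℕ → Fin 3} (hW : SquareFreeSeq W) (i : Fin 3) (s : State) :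
    run W (w s₂ * w R * w Q * w (a i)) (some s) = run W (w R * w (t i) * w (a i) * w Q) (some s) := by
  cases s
  case MP p n =>
    have h := mismatch_of_squareFreeSeq hW p n
    have h₁ := mismatch_iff W (p := p) (n := n) n
    have h₂ := Mismatch.lt (W := W) (p := p + 1) (r := n) (k := n + 1 - (p + 1))
    simp [run_mul, run_w, step, ite_bind]
    generalize Mismatch W (p + 1) n (n + 1 - (p + 1)) = A at *
    generalize Mismatch W p n (n - p) = B at *
    grind
  all_goals simp [run_mul, run_w, step, ite_bind]

theorem step_zero (W : ℕ → Fin 3) (s : State) : step W zero s = none := by cases s <;> rfl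

/-- No transition leads back to `start`, so a letter readable only there fails after any other
letter. -/
theorem run_mul_eq_none_of_start {W : ℕ → Fin 3} {y : Letter}
    (hy : ∀ s, s ≠ .start → step W y s = none) (x : Letter) (s : State) :
    run W (w x * w y) (some s) = run W (w zero) (some s) := by
  simp only [run_mul, run_w, Option.bind_some, step_zero, Option.bind_eq_none_iff]
  rintro s' hs'
  exact hy s' fun h => step_ne_start W x s (h ▸ hs')

theorem run_zero_mul (W : ℕ → Fin 3) (x : Letter) (s : State) :
    run W (w zero * w x) (some s) = run W (w zero) (some s) := by
  simp [run_mul, run_w, step_zero]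

theorem run_L (W : ℕ → Fin 3) (s : State) :
    run W (w L) (some s) = run W (w M * w P * w g) (some s) := by
  cases s <;> simp [run_mul, run_w, step]

theorem step_after_done (W : ℕ → Fin 3) {x : Letter} (hx : ∀ i, x ≠ a i) (n : ℕ) :
    step W x (.done n) = none := by
  cases x <;> simp_all [step]

theorem run_g_mul (W : ℕ → Fin 3) {x : Letter} (hx : ∀ i, x ≠ a i) (s : State) :
    run W (w g * w x) (some s) = run W (w zero) (some s) := by
  simp only [run_mul, run_w, Option.bind_some, step_zero, Option.bind_eq_none_iff]
  intro s' hs'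
  obtain ⟨n, rfl⟩ : ∃ n, s' = .done n := by cases s <;> grind [step]
  exact step_after_done W hx n

theorem run_eq_of_rel {W : ℕ → Fin 3} (hW : SquareFreeSeq W) {u v : FreeSemigroup Letter}
    (h : Rel u v) (s : Option State) : run W u s = run W v s := by
  rcases s with _ | s
  · cases h <;> simp [run_mul, run_w]
  cases h with
  | zero_mul x => exact run_zero_mul W x s
  | mul_zero x => exact run_mul_eq_none_of_start (fun s _ => step_zero W s) x s
  | mul_L x => exact run_mul_eq_none_of_start (fun s hs => by cases s <;> simp_all [step]) x s
  | mul_M x => exact run_mul_eq_none_of_start (fun s hs => by cases s <;> simp_all [step]) x s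
  | L_eq => exact run_L W s
  | g_a i => exact run_g_a W i s
  | g_mul x hx => exact run_g_mul W hx s
  | a_g_a i j => exact run_a_g_a hW i j s
  | t_R i => exact run_t_R W i s
  | t_a i j => exact run_t_a W i j s
  | P_a_t i => exact run_P_a_t W i s
  | P_a_t_ne i j hij => exact run_P_a_t_ne W hij s
  | s₁_a i => exact run_s₁_a W i s
  | s₂_a i => exact run_s₂_a W i s
  | s₁_R => exact run_s₁_R W s
  | s₁_Q_a i => exact run_s₁_Q_a W i s
  | P_R_s₁ => exact run_P_R_s₁ W s
  | s₂_R_a i => exact run_s₂_R_a W i s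
  | s₂_R_Q_a i => exact run_s₂_R_Q_a hW i s

theorem run_eq_of_toH_eq {W : ℕ → Fin 3} (hW : SquareFreeSeq W) {u v : FreeSemigroup Letter}
    (h : toH u = toH v) : run W u = run W v := by
  have hle : conGen Rel ≤ Con.ker (act W) := Con.conGen_le.2 fun u v huv =>
    MulOpposite.unop_injective (funext fun s => run_eq_of_rel hW huv s)
  have : act W u = act W v := hle ((Con.eq _).1 h)
  funext s
  rw [run, run, this]

/-! ### Infinitely many nonzero elements in the ideal, and its two-sidedness. -/

/-- The word `L a_{W 0} ⋯ a_{W n}`. -/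
def prefixWord (W : ℕ → Fin 3) : ℕ → FreeSemigroup Letter
  | 0 => w L * w (a (W 0))
  | n + 1 => prefixWord W n * w (a (W (n + 1)))

theorem run_prefixWord (W : ℕ → Fin 3) (n : ℕ) :
    run W (prefixWord W n) (some .start) = some (.done (n + 1)) := by
  induction n with
  | zero => simp [prefixWord, run_mul, run_w, step]
  | succ n ih => rw [prefixWord, run_mul, ih]; simp [run_w, step]

theorem toH_prefixWord_ne_zero {W : ℕ → Fin 3} (hW : SquareFreeSeq W) (n : ℕ) :
    toH (prefixWord W n) ≠ 0 := by
  intro h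
  have := congrFun (run_eq_of_toH_eq (v := w zero) hW h) (some .start)
  rw [run_prefixWord, run_w] at this
  simp [step] at this

theorem toH_prefixWord_injective {W : ℕ → Fin 3} (hW : SquareFreeSeq W) :
    Function.Injective fun n => toH (prefixWord W n) := by
  intro m n h
  have := congrFun (run_eq_of_toH_eq hW h) (some .start)
  simpa [run_prefixWord] using this

theorem toH_prefixWord_mem_mulPow (W : ℕ → Fin 3) (n : ℕ) :
    toH (prefixWord W n) ∈ mulPow (rightMultiples (letter L)) n := by
  induction n with
  | zero => exact ⟨letter (a (W 0)), rfl⟩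
  | succ n ih => exact Set.mul_mem_mul ih (Set.mem_univ (letter (a (W (n + 1)))))

theorem toH_prefixWord_mem (W : ℕ → Fin 3) (n : ℕ) :
    toH (prefixWord W n) ∈ rightMultiples (letter L) := by
  induction n with
  | zero => exact ⟨letter (a (W 0)), rfl⟩
  | succ n ih =>
    obtain ⟨h, hh⟩ := ih
    exact ⟨h * letter (a (W (n + 1))), by rw [prefixWord, toH_mul, hh, mul_assoc]; rfl⟩

theorem mul_letter_L (h : H) : h * letter L = 0 := by
  obtain ⟨u, rfl⟩ := toH_surjective h
  induction u using FreeSemigroup.recOnMul with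
  | ih1 y => exact toH_eq_of_rel (Rel.mul_L y)
  | ih2 y v _ hv => rw [toH_mul, mul_assoc, hv, mul_zero]

theorem isTwoSidedIdeal_rightMultiples_L : IsTwoSidedIdeal (rightMultiples (letter L)) := by
  refine ⟨⟨_, 0, rfl⟩, ?_⟩
  rintro _ ⟨k, rfl⟩ h
  exact ⟨⟨0, by rw [← mul_assoc, mul_letter_L, zero_mul, mul_zero]⟩, ⟨k * h, mul_assoc _ _ _⟩⟩

/-! ### Finite presentation. -/

instance : Finite Letter := by
  refine Set.finite_univ_iff.1 (Set.Finite.subset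
    (({L, M, P, Q, R, g, s₁, s₂, zero} : Set Letter).toFinite.union
      ((Set.finite_range t).union (Set.finite_range a))) fun x _ => ?_)
  cases x <;> simp

/-- The defining relations, indexed by their kind and the values of their parameters. -/
def relation (q : Fin 19 × Letter × Fin 3 × Fin 3) :
    FreeSemigroup Letter × FreeSemigroup Letter :=
  let (k, x, i, j) := q
  ![(w zero * w x, w zero), (w x * w zero, w zero), (w x * w L, w zero), (w x * w M, w zero),
    (w g * w x, w zero), (w L, w M * w P * w g), (w g * w (a i), w (a i) * w g),
    (w (a i) * w g * w (a j), w (a i) * w R * w s₁ * w Q * w (a j)),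
    (w (t i) * w R, w R * w (t i)), (w (t i) * w (a j), w (a j) * w (t i)),
    (w P * w (a i) * w (t i), w (a i) * w P * w s₁),
    (w P * w (a j) * w (t i), w (a j) * w P * w s₂),
    (w s₁ * w (a i), w (a i) * w s₁), (w s₂ * w (a i), w (a i) * w s₂), (w s₁ * w R, w R * w s₁),
    (w s₁ * w Q * w (a i), w (t i) * w (a i) * w Q), (w P * w R * w s₁, w zero),
    (w s₂ * w R * w (a i), w (a i) * w s₂ * w R),
    (w s₂ * w R * w Q * w (a i), w R * w (t i) * w (a i) * w Q)] k

theorem exists_relation_eq {u v : FreeSemigroup Letter} (h : Rel u v) :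
    ∃ q, relation q = (u, v) := by
  cases h with
  | zero_mul x => exact ⟨(0, x, 0, 0), rfl⟩
  | mul_zero x => exact ⟨(1, x, 0, 0), rfl⟩
  | mul_L x => exact ⟨(2, x, 0, 0), rfl⟩
  | mul_M x => exact ⟨(3, x, 0, 0), rfl⟩
  | g_mul x _ => exact ⟨(4, x, 0, 0), rfl⟩
  | L_eq => exact ⟨(5, L, 0, 0), rfl⟩
  | g_a i => exact ⟨(6, L, i, 0), rfl⟩
  | a_g_a i j => exact ⟨(7, L, i, j), rfl⟩
  | t_R i => exact ⟨(8, L, i, 0), rfl⟩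
  | t_a i j => exact ⟨(9, L, i, j), rfl⟩
  | P_a_t i => exact ⟨(10, L, i, 0), rfl⟩
  | P_a_t_ne i j _ => exact ⟨(11, L, i, j), rfl⟩
  | s₁_a i => exact ⟨(12, L, i, 0), rfl⟩
  | s₂_a i => exact ⟨(13, L, i, 0), rfl⟩
  | s₁_R => exact ⟨(14, L, 0, 0), rfl⟩
  | s₁_Q_a i => exact ⟨(15, L, i, 0), rfl⟩
  | P_R_s₁ => exact ⟨(16, L, 0, 0), rfl⟩
  | s₂_R_a i => exact ⟨(17, L, i, 0), rfl⟩
  | s₂_R_Q_a i => exact ⟨(18, L, i, 0), rfl⟩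

/-- `relation` drops the side conditions of `g_mul` and `P_a_t_ne`, so its range may be larger;
inclusion suffices. -/
theorem finite_rel :
    {p : FreeSemigroup Letter × FreeSemigroup Letter | Rel p.1 p.2}.Finite :=
  (Set.finite_range relation).subset fun _ h => exists_relation_eq h

theorem isFinitelyPresented_H : IsFinitelyPresented H :=
  ⟨Letter, inferInstance, Rel, finite_rel, ⟨MulEquiv.refl _⟩⟩

end SquareFreeIdeal

open SquareFreeIdeal

theorem mainTheorem1 :
    IsFinitelyPresented H ∧
    IsTwoSidedIdeal (rightMultiples (letter Letter.L)) ∧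
    (rightMultiples (letter Letter.L)).Infinite ∧
    (∀ n : ℕ, ∃ x ∈ mulPow (rightMultiples (letter Letter.L)) n, x ≠ 0) ∧
    (∀ (A Y : H) (X Z : WithOne H),
      (A : WithOne H) = X * (Y : WithOne H) * (Y : WithOne H) * Z → letter Letter.L * A = 0) :=
  have hW := squareFreeSeq_ternaryThue
  ⟨isFinitelyPresented_H, isTwoSidedIdeal_rightMultiples_L,
    (Set.infinite_range_of_injective (toH_prefixWord_injective hW)).mono
      (Set.range_subset_iff.2 (toH_prefixWord_mem _)),
    fun n => ⟨_, toH_prefixWord_mem_mulPow _ n, toH_prefixWord_ne_zero hW n⟩,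
    L_mul_eq_zero_of_square⟩
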